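/- For a finite group $G$ let $B(G)$ be its Burnside ring (the Grothendieck ring of isomorphism classes of finite $G$-sets under disjoint union and cartesian product), and for $U\le G$ let $x\mapsto |x^U|$ be the ring homomorphism $B(G)\to\mathbb Z$ counting $U$-fixed points. If $C$ is a cyclic group of order $|G|$, there is a unique ring homomorphism $\alpha^G:B(C)\to B(G)$, the Frobenius–Wielandt morphism, such that $|\alpha^G(x)^U|=|x^{C_{|U|}}|$ for every $x\in B(C)$ and every $U\le G$, where $C_{|U|}$ denotes the unique subgroup of $C$ of order $|U|$. Lemma. Let $G$ be a finite group, $H\le G$ a subgroup, $C$ a cyclic group of order $|G|$, and $C_H$ the subgroup of $C$ of order $|H|$. Let $\alpha^G:B(C)\to B(G)$ and $\alpha^H:B(C_H)\to B(H)$ be the Frobenius–Wielandt morphisms, and let $\mathrm{Ind}_H^G:B(H)\to B(G)$, $[X]\mapsto[G\times_H X]$, and $\mathrm{Ind}_{C_H}^C:B(C_H)\to B(C)$ be the induction morphisms. Then $$\alpha^G\circ \mathrm{Ind}_{C_H}^{C}=\mathrm{Ind}_H^G\circ\alpha^H$$ if and only if $G$ and $H$ have the gcd property, that is, $|K\cap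 H|=\gcd(|K|,|H|)$ for every subgroup $K\le G$. Moreover, if $G$ and $H$ have the gcd property, then $H$ is normal in $G$. -/

import Mathlib

universe u v

/-- A finite (left) `G`-set. -/
structure FinGSet (G : Type u) [Group G] where
  carrier : Type u
  [action : MulAction G carrier]
  [finite : Finite carrier]

namespace FinGSet

attribute [instance] FinGSet.action FinGSet.finite

section

variable {G : Type u} [Group G]

/-- Isomorphism of finite `G`-sets: there is a `G`-equivariant bijection. -/
def Iso (X Y : FinGSet G) : Prop :=
  ∃ e : X.carrier ≃ Y.carrier, ∀ (g : G) (x : X.carrier), e (g • x) = g • e x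

theorem Iso.refl (X : FinGSet G) : Iso X X := ⟨Equiv.refl _, fun _ _ => rfl⟩

theorem Iso.symm {X Y : FinGSet G} : Iso X Y → Iso Y X := by
  rintro ⟨e, he⟩
  refine ⟨e.symm, fun g y => ?_⟩
  rw [Equiv.symm_apply_eq, he, Equiv.apply_symm_apply]

theorem Iso.trans {X Y Z : FinGSet G} : Iso X Y → Iso Y Z → Iso X Z := by
  rintro ⟨e, he⟩ ⟨f, hf⟩
  exact ⟨e.trans f, fun g x => by simp [he, hf]⟩

/-- The setoid of isomorphism of finite `G`-sets. -/
instance isoSetoid (G : Type u) [Group G] : Setoid (FinGSet G) :=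
  ⟨Iso, Iso.refl, Iso.symm, Iso.trans⟩

/-- The empty `G`-set. -/
def empty (G : Type u) [Group G] : FinGSet G :=
  letI : MulAction G PEmpty.{u + 1} :=
    { smul := fun _ x => x, one_smul := fun _ => rfl, mul_smul := fun _ _ _ => rfl }
  ⟨PEmpty.{u + 1}⟩

/-- The one-point `G`-set. -/
def point (G : Type u) [Group G] : FinGSet G :=
  letI : MulAction G PUnit.{u + 1} :=
    { smul := fun _ x => x, one_smul := fun _ => rfl, mul_smul := fun _ _ _ => rfl }
  ⟨PUnit.{u + 1}⟩

/-- The action of `G` on the disjoint union of two `G`-sets. -/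
instance sumAction (X Y : FinGSet G) : MulAction G (X.carrier ⊕ Y.carrier) where
  smul g := Sum.map (g • ·) (g • ·)
  one_smul := by
    rintro (x | y)
    · exact congrArg Sum.inl (one_smul G x)
    · exact congrArg Sum.inr (one_smul G y)
  mul_smul g h := by
    rintro (x | y)
    · exact congrArg Sum.inl (mul_smul g h x)
    · exact congrArg Sum.inr (mul_smul g h y)

/-- Disjoint union of finite `G`-sets. -/
def sum (X Y : FinGSet G) : FinGSet G := @FinGSet.mk G _ (X.carrier ⊕ Y.carrier) (sumAction X Y) _

/-- Cartesian product of finite `G`-sets, with the diagonal action. -/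
def prod (X Y : FinGSet G) : FinGSet G := ⟨X.carrier × Y.carrier⟩

/-- The relation on `G × X` whose quotient is `G ×_H X`: `(g, x) ∼ (g h⁻¹, h x)` for `h ∈ H`. -/
def indSetoid (H : Subgroup G) (X : FinGSet H) : Setoid (G × X.carrier) where
  r p q := ∃ h : H, q = (p.1 * (h : G)⁻¹, h • p.2)
  iseqv :=
    { refl := fun p => ⟨1, by simp⟩
      symm := by
        rintro p _ ⟨h, rfl⟩
        exact ⟨h⁻¹, by simp⟩
      trans := by
        rintro p _ _ ⟨h, rfl⟩ ⟨k, rfl⟩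
        exact ⟨k * h, by simp [mul_smul, mul_assoc]⟩ }

/-- The action of `G` on `G ×_H X` given by `g • [a, x] = [g a, x]`. -/
instance indAction (H : Subgroup G) (X : FinGSet H) : MulAction G (Quotient (indSetoid H X)) where
  smul g := Quotient.map (fun p => (g * p.1, p.2)) (by
    rintro p _ ⟨h, rfl⟩
    exact ⟨h, by simp [mul_assoc]⟩)
  one_smul := by
    rintro ⟨p⟩
    exact congrArg (Quotient.mk _) (by simp)
  mul_smul g k := by
    rintro ⟨p⟩
    exact congrArg (Quotient.mk _) (by simp [mul_assoc])

/-- The induced `G`-set `G ×_H X` of a finite `H`-set `X`. -/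
def ind [Finite G] (H : Subgroup G) (X : FinGSet H) : FinGSet G := ⟨Quotient (indSetoid H X)⟩

/-- The number `|X^U|` of points of `X` fixed by the subgroup `U`. -/
noncomputable def numFixed (U : Subgroup G) (X : FinGSet G) : ℕ :=
  Nat.card {x : X.carrier // ∀ g ∈ U, g • x = x}

theorem sum_iso {X X' Y Y' : FinGSet G} : Iso X X' → Iso Y Y' → Iso (sum X Y) (sum X' Y') := by
  rintro ⟨e, he⟩ ⟨f, hf⟩
  refine ⟨Equiv.sumCongr e f, fun g => ?_⟩
  rintro (x | y)
  · exact congrArg Sum.inl (he g x)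
  · exact congrArg Sum.inr (hf g y)

theorem prod_iso {X X' Y Y' : FinGSet G} : Iso X X' → Iso Y Y' → Iso (prod X Y) (prod X' Y') := by
  rintro ⟨e, he⟩ ⟨f, hf⟩
  exact ⟨Equiv.prodCongr e f, fun g p => Prod.ext (he g p.1) (hf g p.2)⟩

theorem ind_iso [Finite G] (H : Subgroup G) {X Y : FinGSet H} :
    Iso X Y → Iso (ind H X) (ind H Y) := by
  rintro ⟨e, he⟩
  refine ⟨Quotient.congr (Equiv.prodCongr (Equiv.refl G) e) ?_, ?_⟩
  · rintro ⟨a, x⟩ ⟨b, y⟩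
    constructor
    · rintro ⟨h, hh⟩
      obtain ⟨rfl, rfl⟩ := Prod.mk.inj hh
      exact ⟨h, Prod.ext rfl (he h x)⟩
    · rintro ⟨h, hh⟩
      obtain ⟨h1, h2⟩ := Prod.mk.inj hh
      exact ⟨h, Prod.ext h1 (e.injective (h2.trans (he h x).symm))⟩
  · rintro g ⟨p⟩
    rfl

theorem ind_empty [Finite G] (H : Subgroup G) : Iso (ind H (empty H)) (empty G) := by
  have : IsEmpty (ind H (empty H)).carrier := ⟨by rintro ⟨p⟩; exact p.2.elim⟩
  have : IsEmpty (empty G).carrier := inferInstanceAs (IsEmpty PEmpty)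
  exact ⟨Equiv.equivOfIsEmpty _ _, fun g x => isEmptyElim x⟩

theorem ind_sum [Finite G] (H : Subgroup G) (X Y : FinGSet H) :
    Iso (sum (ind H X) (ind H Y)) (ind H (sum X Y)) := by
  let F : Quotient (indSetoid H X) ⊕ Quotient (indSetoid H Y) →
      Quotient (indSetoid H (sum X Y)) :=
    Sum.elim
      (Quotient.map (fun p => (p.1, Sum.inl p.2)) (by
        rintro p _ ⟨h, rfl⟩
        exact ⟨h, rfl⟩))
      (Quotient.map (fun p => (p.1, Sum.inr p.2)) (by
        rintro p _ ⟨h, rfl⟩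
        exact ⟨h, rfl⟩))
  have hF : Function.Bijective F := by
    refine ⟨?_, ?_⟩
    · rintro (p | p) (q | q) hpq <;> obtain ⟨p⟩ := p <;> obtain ⟨q⟩ := q
      · obtain ⟨h, hh⟩ := Quotient.exact (s := indSetoid H (sum X Y)) hpq
        obtain ⟨h1, h2⟩ := Prod.mk.inj hh
        exact congrArg Sum.inl (Quotient.sound ⟨h, Prod.ext h1 (Sum.inl.inj h2)⟩)
      · obtain ⟨h, hh⟩ := Quotient.exact (s := indSetoid H (sum X Y)) hpq
        exact absurd (Prod.mk.inj hh).2 Sum.inr_ne_inl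
      · obtain ⟨h, hh⟩ := Quotient.exact (s := indSetoid H (sum X Y)) hpq
        exact absurd (Prod.mk.inj hh).2 Sum.inl_ne_inr
      · obtain ⟨h, hh⟩ := Quotient.exact (s := indSetoid H (sum X Y)) hpq
        obtain ⟨h1, h2⟩ := Prod.mk.inj hh
        exact congrArg Sum.inr (Quotient.sound ⟨h, Prod.ext h1 (Sum.inr.inj h2)⟩)
    · rintro ⟨a, x | y⟩
      · exact ⟨Sum.inl (Quotient.mk _ (a, x)), rfl⟩
      · exact ⟨Sum.inr (Quotient.mk _ (a, y)), rfl⟩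
  have hg : ∀ (g : G) (z : Quotient (indSetoid H X) ⊕ Quotient (indSetoid H Y)),
      F (Sum.map (g • ·) (g • ·) z) = g • F z := by
    rintro g (p | p) <;> induction p using Quotient.inductionOn <;> rfl
  exact ⟨Equiv.ofBijective F hF, hg⟩

theorem numFixed_iso (U : Subgroup G) {X Y : FinGSet G} :
    Iso X Y → numFixed U X = numFixed U Y := by
  rintro ⟨e, he⟩
  exact Nat.card_congr (e.subtypeEquiv fun x => by simp [← he])

theorem numFixed_empty (U : Subgroup G) : numFixed U (empty G) = 0 := by
  have : IsEmpty (empty G).carrier := inferInstanceAs (IsEmpty PEmpty)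
  exact Nat.card_of_isEmpty

theorem numFixed_point (U : Subgroup G) : numFixed U (point G) = 1 :=
  Nat.card_eq_one_iff_exists.2 ⟨⟨PUnit.unit, fun _ _ => rfl⟩, fun _ => rfl⟩

theorem numFixed_sum (U : Subgroup G) (X Y : FinGSet G) :
    numFixed U (sum X Y) = numFixed U X + numFixed U Y := by
  unfold numFixed
  rw [← Nat.card_sum]
  refine Nat.card_congr (Equiv.trans Equiv.subtypeSum (Equiv.sumCongr ?_ ?_))
  · exact Equiv.subtypeEquivRight fun x => forall₂_congr fun g _ =>
      ⟨fun h => Sum.inl.inj h, fun h => congrArg Sum.inl h⟩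
  · exact Equiv.subtypeEquivRight fun x => forall₂_congr fun g _ =>
      ⟨fun h => Sum.inr.inj h, fun h => congrArg Sum.inr h⟩

theorem numFixed_prod (U : Subgroup G) (X Y : FinGSet G) :
    numFixed U (prod X Y) = numFixed U X * numFixed U Y := by
  unfold numFixed
  rw [← Nat.card_prod]
  refine Nat.card_congr (Equiv.trans (Equiv.subtypeEquivRight fun p => ?_)
    (Equiv.subtypeProdEquivProd (p := fun x : X.carrier => ∀ g ∈ U, g • x = x)
      (q := fun y : Y.carrier => ∀ g ∈ U, g • y = y)))
  exact ⟨fun h => ⟨fun g hg => (Prod.mk.inj (h g hg)).1, fun g hg => (Prod.mk.inj (h g hg)).2⟩,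
    fun h g hg => Prod.ext (h.1 g hg) (h.2 g hg)⟩

end

end FinGSet

/-- The isomorphism classes of finite `G`-sets. -/
def GSetClass (G : Type u) [Group G] : Type (u + 1) := Quotient (FinGSet.isoSetoid G)

namespace GSetClass

open FinGSet

section

variable {G : Type u} [Group G]

/-- The isomorphism class of a finite `G`-set. -/
def mk (X : FinGSet G) : GSetClass G := Quotient.mk _ X

instance : Zero (GSetClass G) := ⟨mk (empty G)⟩

instance : One (GSetClass G) := ⟨mk (point G)⟩

instance : Add (GSetClass G) := ⟨Quotient.map₂ sum fun _ _ h _ _ k => sum_iso h k⟩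

instance : Mul (GSetClass G) := ⟨Quotient.map₂ prod fun _ _ h _ _ k => prod_iso h k⟩

/-- The commutative semiring of isomorphism classes of finite `G`-sets: the sum is the disjoint
union, the product is the cartesian product. -/
instance : CommSemiring (GSetClass G) where
  nsmul := nsmulRec
  npow := npowRec
  add_assoc := by
    rintro ⟨X⟩ ⟨Y⟩ ⟨Z⟩
    refine Quotient.sound ⟨Equiv.sumAssoc _ _ _, ?_⟩
    rintro g ((x | y) | z) <;> rfl
  add_comm := by
    rintro ⟨X⟩ ⟨Y⟩
    refine Quotient.sound ⟨Equiv.sumComm _ _, ?_⟩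
    rintro g (x | y) <;> rfl
  zero_add := by
    rintro ⟨X⟩
    refine Quotient.sound ⟨Equiv.emptySum PEmpty _, ?_⟩
    rintro g (x | y)
    · exact x.elim
    · rfl
  add_zero := by
    rintro ⟨X⟩
    refine Quotient.sound ⟨Equiv.sumEmpty _ PEmpty, ?_⟩
    rintro g (x | y)
    · rfl
    · exact y.elim
  mul_assoc := by
    rintro ⟨X⟩ ⟨Y⟩ ⟨Z⟩
    exact Quotient.sound ⟨Equiv.prodAssoc _ _ _, fun _ _ => rfl⟩
  mul_comm := by
    rintro ⟨X⟩ ⟨Y⟩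
    exact Quotient.sound ⟨Equiv.prodComm _ _, fun _ _ => rfl⟩
  one_mul := by
    rintro ⟨X⟩
    exact Quotient.sound ⟨Equiv.punitProd _, fun _ _ => rfl⟩
  mul_one := by
    rintro ⟨X⟩
    exact Quotient.sound ⟨Equiv.prodPUnit _, fun _ _ => rfl⟩
  zero_mul := by
    rintro ⟨X⟩
    exact Quotient.sound ⟨Equiv.pemptyProd _, fun _ p => p.1.elim⟩
  mul_zero := by
    rintro ⟨X⟩
    exact Quotient.sound ⟨Equiv.prodPEmpty _, fun _ p => p.2.elim⟩
  left_distrib := by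
    rintro ⟨X⟩ ⟨Y⟩ ⟨Z⟩
    refine Quotient.sound ⟨Equiv.prodSumDistrib _ _ _, ?_⟩
    rintro g ⟨x, y | z⟩ <;> rfl
  right_distrib := by
    rintro ⟨X⟩ ⟨Y⟩ ⟨Z⟩
    refine Quotient.sound ⟨Equiv.sumProdDistrib _ _ _, ?_⟩
    rintro g ⟨x | y, z⟩ <;> rfl

/-- The number of `U`-fixed points, on isomorphism classes. -/
noncomputable def fixed (U : Subgroup G) : GSetClass G →+* ℕ where
  toFun := Quotient.lift (numFixed U) fun _ _ h => numFixed_iso U h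
  map_zero' := numFixed_empty U
  map_one' := numFixed_point U
  map_add' := by
    rintro ⟨X⟩ ⟨Y⟩
    exact numFixed_sum U X Y
  map_mul' := by
    rintro ⟨X⟩ ⟨Y⟩
    exact numFixed_prod U X Y

/-- Induction `X ↦ G ×_H X`, on isomorphism classes. -/
def ind [Finite G] (H : Subgroup G) : GSetClass H →+ GSetClass G where
  toFun := Quotient.map (FinGSet.ind H) fun _ _ h => ind_iso H h
  map_zero' := Quotient.sound (ind_empty H)
  map_add' := by
    rintro ⟨X⟩ ⟨Y⟩
    exact (Quotient.sound (ind_sum H X Y)).symm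

end

end GSetClass

/-- The Burnside ring `B(G)`: the Grothendieck group of the monoid of isomorphism classes of
finite `G`-sets under disjoint union, with the product induced by the cartesian product. -/
def BurnsideRing (G : Type u) [Group G] : Type (u + 1) :=
  Algebra.GrothendieckAddGroup (GSetClass G)

namespace BurnsideRing

section

variable {G : Type u} [Group G]

instance : AddCommGroup (BurnsideRing G) :=
  inferInstanceAs (AddCommGroup (Algebra.GrothendieckAddGroup (GSetClass G)))

/-- The canonical map from isomorphism classes of finite `G`-sets to the Burnside ring. -/
def of : GSetClass G →+ BurnsideRing G := Algebra.GrothendieckAddGroup.of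

/-- Extension of an additive map on isomorphism classes of finite `G`-sets to `B(G)`. -/
noncomputable def lift {A : Type*} [AddCommGroup A] (f : GSetClass G →+ A) : BurnsideRing G →+ A :=
  Algebra.GrothendieckAddGroup.lift f

theorem lift_of {A : Type*} [AddCommGroup A] (f : GSetClass G →+ A) (x : GSetClass G) :
    lift f (of x) = f x :=
  DFunLike.congr_fun (Algebra.GrothendieckAddGroup.lift.symm_apply_apply f) x

theorem hom_ext {A : Type*} [AddCommGroup A] {f g : BurnsideRing G →+ A}
    (h : ∀ x : GSetClass G, f (of x) = g (of x)) : f = g :=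
  Algebra.GrothendieckAddGroup.lift.symm.injective (AddMonoidHom.ext h)

/-- The multiplication of `B(G)`: the biadditive extension of the product of `G`-sets. -/
noncomputable def mulHom : BurnsideRing G →+ BurnsideRing G →+ BurnsideRing G :=
  lift
    { toFun := fun x => lift (of.comp (AddMonoidHom.mulLeft x))
      map_zero' := hom_ext fun y => by simp [lift_of]
      map_add' := fun x x' => hom_ext fun y => by simp [lift_of, add_mul] }

theorem mulHom_of (x y : GSetClass G) : mulHom (of x) (of y) = of (x * y) := by
  simp [mulHom, lift_of]

theorem induction_on {p : BurnsideRing G → Prop} (a : BurnsideRing G)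
    (h : ∀ x y : GSetClass G, p (of x - of y)) : p a := by
  obtain ⟨⟨x, y⟩, hxy⟩ := (AddLocalization.addMonoidOf (⊤ : AddSubmonoid (GSetClass G))).surj a
  have : a = of x - of y.1 := eq_sub_of_add_eq hxy
  rw [this]
  exact h x y.1

noncomputable instance : Mul (BurnsideRing G) := ⟨fun a b => mulHom a b⟩

instance : One (BurnsideRing G) := ⟨of 1⟩

noncomputable instance : CommRing (BurnsideRing G) where
  __ := (inferInstance : AddCommGroup (BurnsideRing G))
  npow := npowRec
  left_distrib a b c := map_add (mulHom a) b c
  right_distrib a b c := by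
    change mulHom (a + b) c = mulHom a c + mulHom b c
    rw [map_add, AddMonoidHom.add_apply]
  zero_mul a := by
    change mulHom 0 a = 0
    rw [map_zero, AddMonoidHom.zero_apply]
  mul_zero a := map_zero (mulHom a)
  mul_assoc a b c := by
    change mulHom (mulHom a b) c = mulHom a (mulHom b c)
    induction a using induction_on with | h x x' =>
    induction b using induction_on with | h y y' =>
    induction c using induction_on with | h z z' =>
    simp only [map_sub, AddMonoidHom.sub_apply, mulHom_of, mul_assoc]
  mul_comm a b := by
    change mulHom a b = mulHom b a
    induction a using induction_on with | h x x' =>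
    induction b using induction_on with | h y y' =>
    simp only [map_sub, AddMonoidHom.sub_apply, mulHom_of, mul_comm]
    abel
  one_mul a := by
    change mulHom (of 1) a = a
    induction a using induction_on with | h x x' =>
    simp only [map_sub, mulHom_of, one_mul]
  mul_one a := by
    change mulHom a (of 1) = a
    induction a using induction_on with | h x x' =>
    simp only [map_sub, AddMonoidHom.sub_apply, mulHom_of, mul_one]

theorem of_mul (x y : GSetClass G) : (of (x * y) : BurnsideRing G) = of x * of y :=
  (mulHom_of x y).symm

/-- The additive extension to `B(G)` of `X ↦ |X^U|`. -/
noncomputable def fixedAddHom (U : Subgroup G) : BurnsideRing G →+ ℤ :=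
  lift ((Nat.castAddMonoidHom ℤ).comp (GSetClass.fixed U : GSetClass G →+ ℕ))

theorem fixedAddHom_of (U : Subgroup G) (x : GSetClass G) :
    fixedAddHom U (of x) = (GSetClass.fixed U x : ℤ) :=
  lift_of _ x

/-- The ring homomorphism of fixed points `B(G) → ℤ`, `x ↦ |x^U|`. -/
noncomputable def fixed (U : Subgroup G) : BurnsideRing G →+* ℤ where
  __ := fixedAddHom U
  map_one' := (fixedAddHom_of U 1).trans (by simp)
  map_mul' a b := by
    change fixedAddHom U (a * b) = fixedAddHom U a * fixedAddHom U b
    induction a using induction_on with | h x x' =>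
    induction b using induction_on with | h y y' =>
    simp only [sub_mul, mul_sub, map_sub, ← of_mul, fixedAddHom_of, map_mul, Nat.cast_mul]

/-- The induction morphism `Ind_H^G : B(H) → B(G)`, `[X] ↦ [G ×_H X]`. -/
noncomputable def ind [Finite G] (H : Subgroup G) : BurnsideRing H →+ BurnsideRing G :=
  lift (of.comp (GSetClass.ind H))

end

end BurnsideRing

/-- The property that characterizes the Frobenius–Wielandt morphism `α : B(C) → B(G)`, where `C` is
a cyclic group of order `|G|`: for every subgroup `U` of `G` and every `x ∈ B(C)`,
`|α(x)^U| = |x^V|`, where `V` is the subgroup of `C` of order `|U|`. -/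
def IsFrobeniusWielandt {C : Type v} [Group C] {G : Type u} [Group G]
    (α : BurnsideRing C →+* BurnsideRing G) : Prop :=
  ∀ (U : Subgroup G) (V : Subgroup C), Nat.card V = Nat.card U →
    ∀ x : BurnsideRing C, BurnsideRing.fixed U (α x) = BurnsideRing.fixed V x

/-- The gcd property of `G` and `N ≤ G`: `|K ∩ N| = gcd(|K|, |N|)` for every subgroup `K`. -/
def GcdProperty {G : Type u} [Group G] (N : Subgroup G) : Prop :=
  ∀ K : Subgroup G, Nat.card (K ⊓ N : Subgroup G) = Nat.gcd (Nat.card K) (Nat.card N)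

/-! Elements of `B(G)` are determined by their marks (Burnside), so the identity can be tested mark
by mark. The marks of an induced element satisfy `|Ind_H^G(x)^U| · |H| = ∑_g |x^(g⁻¹Ug)|`, summed
over the `g` with `g⁻¹Ug ≤ H` (`fixed_ind_mul_card`). In a cyclic group a subgroup is determined by
its order. If `|U|` divides `|H|`, all terms on the `C` side are therefore equal, and the mark at
`U` of `α^G(Ind x)` is `|G|/|H|` times a mark of `x`.

Evaluate at `x = 1`: the sum for `Ind_H^G 1` counts the `g` with `g⁻¹Ug ≤ H`, so the identity forces
every `g` to count, in particular `g = 1`, and `U ≤ H`. Conversely, if every `U` with `|U|` dividing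
`|H|` lies in `H`, the two sums agree term by term; for the other `U` both marks vanish. This
containment condition is equivalent to the gcd property (`gcdProperty_iff`, through `p`-subgroups),
and it gives normality because conjugates of `H` have order `|H|`.

Existence of `α` rests on the `G`-set of `d`-element subsets of `G`, whose marks depend only on
`|G|`, `|U|` and `d`. Over `C` these sets generate all the classes `[C/V]`, by induction on `|V|`.
-/

namespace FinGSet

/-! ### Orbit decomposition and Burnside's theorem on marks. -/

variable {G : Type u} [Group G]

open MulAction

/-- The transitive `G`-set of left cosets of `U`. -/
def coset [Finite G] (U : Subgroup G) : FinGSet G := ⟨G ⧸ U⟩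

/-- The orbit of a point. -/
def orb (X : FinGSet G) (x : X.carrier) : FinGSet G := ⟨orbit G x⟩

/-- The complement of the orbit of a point. -/
def orbCompl (X : FinGSet G) (x : X.carrier) : FinGSet G :=
  letI : MulAction G {y : X.carrier // y ∉ orbit G x} :=
    { smul := fun g y => ⟨g • y.1, fun ⟨k, hk⟩ => y.2
        ⟨g⁻¹ * k, (mul_smul _ _ _).trans (inv_smul_eq_iff.2 hk)⟩⟩
      one_smul := fun y => Subtype.ext (one_smul G y.1)
      mul_smul := fun g h y => Subtype.ext (mul_smul g h y.1) }
  ⟨{y : X.carrier // y ∉ orbit G x}⟩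

theorem iso_orb_coset [Finite G] (X : FinGSet G) (x : X.carrier) :
    Iso (orb X x) (coset (stabilizer G x)) := by
  refine Iso.symm ⟨(orbitEquivQuotientStabilizer G x).symm, ?_⟩
  rintro g ⟨a⟩
  exact Subtype.ext (mul_smul g a x)

theorem iso_sum_orbCompl (X : FinGSet G) (x : X.carrier) :
    Iso (sum (orb X x) (orbCompl X x)) X := by
  classical
  refine ⟨Equiv.sumCompl (fun y => y ∈ orbit G x), ?_⟩
  rintro g (y | y) <;> rfl

/-- Splitting off one orbit is the step of every induction on the size of a `G`-set below. -/
theorem iso_coset_sum_orbCompl [Finite G] (X : FinGSet G) (x : X.carrier) :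
    Iso (sum (coset (stabilizer G x)) (orbCompl X x)) X :=
  (sum_iso (iso_orb_coset X x).symm (Iso.refl _)).trans (iso_sum_orbCompl X x)

theorem stabilizer_orbCompl (X : FinGSet G) (x : X.carrier) (y : (orbCompl X x).carrier) :
    stabilizer G y = stabilizer G (y.1 : X.carrier) := by
  ext g
  exact Subtype.ext_iff

theorem card_orbCompl_lt (X : FinGSet G) (x : X.carrier) :
    Nat.card (orbCompl X x).carrier < Nat.card X.carrier :=
  Finite.card_subtype_lt (x := x) (not_not.2 (mem_orbit_self x))

theorem numFixed_bot (X : FinGSet G) : numFixed ⊥ X = Nat.card X.carrier :=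
  Nat.card_congr (Equiv.subtypeUnivEquiv fun x g hg => by
    rw [Subgroup.mem_bot.1 hg, one_smul])

theorem numFixed_pos_iff (U : Subgroup G) (X : FinGSet G) :
    0 < numFixed U X ↔ ∃ x : X.carrier, U ≤ stabilizer G x := by
  unfold numFixed
  rw [Nat.card_pos_iff]
  exact ⟨fun ⟨⟨x⟩, _⟩ => ⟨x.1, x.2⟩, fun ⟨x, hx⟩ => ⟨⟨⟨x, hx⟩⟩, inferInstance⟩⟩

/-- **Burnside**: finite `G`-sets with the same numbers of fixed points are isomorphic. -/
theorem iso_of_numFixed_eq [Finite G] {X Y : FinGSet G}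
    (h : ∀ U : Subgroup G, numFixed U X = numFixed U Y) : Iso X Y := by
  induction hn : Nat.card X.carrier using Nat.strong_induction_on generalizing X Y with
  | _ n ih =>
  rcases isEmpty_or_nonempty X.carrier with hX | hX
  · have : Nat.card Y.carrier = 0 := by
      rw [← numFixed_bot, ← h, numFixed_bot, Nat.card_of_isEmpty]
    have hY : IsEmpty Y.carrier := (Nat.card_eq_zero.1 this).resolve_right (not_infinite_iff_finite.2 inferInstance)
    exact ⟨Equiv.equivOfIsEmpty _ _, fun g x => isEmptyElim x⟩
  -- Choose `x` with stabilizer of maximal order. Positivity of marks passes from `x` to some `y` in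
  -- `Y` and back to some `z` in `X` with growing stabilizers; maximality makes the first two equal.
  -- The orbits of `x` and `y` are then isomorphic and can be cancelled.
  · obtain ⟨x, hx⟩ := Finite.exists_max fun x : X.carrier => Nat.card (stabilizer G x)
    obtain ⟨y, hy⟩ := (numFixed_pos_iff (stabilizer G x) Y).1
      (h _ ▸ (numFixed_pos_iff _ X).2 ⟨x, le_rfl⟩)
    obtain ⟨z, hz⟩ := (numFixed_pos_iff (stabilizer G y) X).1
      (h _ ▸ (numFixed_pos_iff _ Y).2 ⟨y, le_rfl⟩)
    have hxy : stabilizer G x = stabilizer G y :=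
      Subgroup.eq_of_le_of_card_ge hy ((Subgroup.card_le_of_le hz).trans (hx z))
    have hX' := iso_coset_sum_orbCompl X x
    have hY' := iso_coset_sum_orbCompl Y y
    rw [← hxy] at hY'
    have hc : Iso (orbCompl X x) (orbCompl Y y) := by
      refine ih _ (hn ▸ card_orbCompl_lt X x) (fun U => ?_) rfl
      have := h U
      rw [← numFixed_iso U hX', ← numFixed_iso U hY', numFixed_sum, numFixed_sum] at this
      exact Nat.add_left_cancel this
    exact hX'.symm.trans ((sum_iso (Iso.refl _) hc).trans hY')

end FinGSet

namespace BurnsideRing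

variable {G : Type u} [Group G]

theorem fixed_of_mk (U : Subgroup G) (X : FinGSet G) :
    fixed U (of (GSetClass.mk X)) = (FinGSet.numFixed U X : ℤ) :=
  fixedAddHom_of U _

theorem ext_fixed [Finite G] {a b : BurnsideRing G}
    (h : ∀ U : Subgroup G, fixed U a = fixed U b) : a = b := by
  rw [← sub_eq_zero]
  have h' : ∀ U : Subgroup G, fixed U (a - b) = 0 := fun U => by rw [map_sub, h, sub_self]
  generalize a - b = c at h'
  induction c using induction_on with | h x y =>
  obtain ⟨X, rfl⟩ := Quotient.exists_rep x
  obtain ⟨Y, rfl⟩ := Quotient.exists_rep y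
  rw [sub_eq_zero]
  refine congrArg of (Quotient.sound (FinGSet.iso_of_numFixed_eq fun U => ?_))
  have := h' U
  rw [map_sub, sub_eq_zero] at this
  exact_mod_cast (fixed_of_mk U X).symm.trans (this.trans (fixed_of_mk U Y))

end BurnsideRing

/-! ### Subgroups of cyclic groups, and a bijection matching cosets. -/

theorem IsCyclic.subgroup_le_of_card_dvd {C : Type v} [Group C] [Finite C] [IsCyclic C]
    {V W : Subgroup C} (h : Nat.card V ∣ Nat.card W) : V ≤ W := by
  classical
  have := Fintype.ofFinite C
  have hW : 0 < Nat.card W := Nat.card_pos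
  have hsub : (W : Set C).toFinset ⊆ Finset.univ.filter fun a : C => a ^ Nat.card W = 1 := by
    intro a ha
    have ha' : a ∈ W := by simpa using ha
    exact Finset.mem_filter.2 ⟨Finset.mem_univ a,
      congrArg Subtype.val (pow_card_eq_one' (x := (⟨a, ha'⟩ : W)))⟩
  -- In a cyclic group `a ^ |W| = 1` has at most `|W|` solutions, and `W` already supplies that
  -- many.
  have heq := Finset.eq_of_subset_of_card_le hsub
    ((IsCyclic.card_pow_eq_one_le hW).trans (by rw [Set.toFinset_card]; exact (Nat.card_eq_fintype_card).le))
  intro a ha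
  have hpow : a ^ Nat.card V = 1 :=
    congrArg Subtype.val (pow_card_eq_one' (x := (⟨a, ha⟩ : V)))
  have : a ∈ Finset.univ.filter fun a : C => a ^ Nat.card W = 1 := by
    obtain ⟨k, hk⟩ := h
    exact Finset.mem_filter.2 ⟨Finset.mem_univ a, by rw [hk, pow_mul, hpow, one_pow]⟩
  rw [← heq] at this
  simpa using this

theorem IsCyclic.subgroup_eq_of_card_eq {C : Type v} [Group C] [Finite C] [IsCyclic C]
    {V W : Subgroup C} (h : Nat.card V = Nat.card W) : V = W :=
  le_antisymm (subgroup_le_of_card_dvd h.dvd) (subgroup_le_of_card_dvd h.symm.dvd)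

theorem IsCyclic.exists_subgroup_card_eq {C : Type v} [Group C] [Finite C] [IsCyclic C] {d : ℕ}
    (h : d ∣ Nat.card C) : ∃ V : Subgroup C, Nat.card V = d := by
  obtain ⟨g, hg⟩ := IsCyclic.exists_ofOrder_eq_natCard (α := C)
  obtain ⟨k, hk⟩ := h
  have h0 : 0 < Nat.card C := Nat.card_pos
  have hk0 : k ≠ 0 := by rintro rfl; omega
  refine ⟨Subgroup.zpowers (g ^ k), ?_⟩
  rw [Nat.card_zpowers, orderOf_pow_of_dvd hk0 (by rw [hg, hk]; exact dvd_mul_left _ _), hg, hk,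
    Nat.mul_div_cancel _ (Nat.pos_of_ne_zero hk0)]

/-- Both groups split into equally many cosets of equal size, so some bijection carries the right
cosets of `V` to those of `U`. -/
theorem Subgroup.exists_equiv_mul_inv_mem_iff {C : Type v} [Group C] [Finite C] {G : Type u}
    [Group G] [Finite G] (hC : Nat.card C = Nat.card G) {V : Subgroup C} {U : Subgroup G}
    (h : Nat.card V = Nat.card U) :
    ∃ e : C ≃ G, ∀ x y, x * y⁻¹ ∈ V ↔ e x * (e y)⁻¹ ∈ U := by
  have hq : Nat.card (C ⧸ V) = Nat.card (G ⧸ U) := by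
    rw [V.card_eq_card_quotient_mul_card_subgroup, U.card_eq_card_quotient_mul_card_subgroup,
      h] at hC
    exact Nat.eq_of_mul_eq_mul_right Nat.card_pos hC
  let e₁ : (C ⧸ V) ≃ (G ⧸ U) := (Finite.card_eq.1 hq).some
  let e₂ : V ≃ U := (Finite.card_eq.1 h).some
  let f : C ≃ G := V.groupEquivQuotientProdSubgroup.trans
    ((Equiv.prodCongr e₁ e₂).trans U.groupEquivQuotientProdSubgroup.symm)
  have hf1 : ∀ x : C, (V.groupEquivQuotientProdSubgroup x).1 = (x : C ⧸ V) := fun x => rfl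
  have hf2 : ∀ x : G, (U.groupEquivQuotientProdSubgroup x).1 = (x : G ⧸ U) := fun x => rfl
  have hf : ∀ x : C, (f x : G ⧸ U) = e₁ (x : C ⧸ V) := fun x => by
    rw [← hf1, ← hf2]; simp [f]
  -- `f` matches left cosets; inversion on both sides turns them into right cosets.
  refine ⟨(Equiv.inv C).trans (f.trans (Equiv.inv G)), fun x y => ?_⟩
  have h1 : x * y⁻¹ ∈ V ↔ ((x⁻¹ : C) : C ⧸ V) = ((y⁻¹ : C) : C ⧸ V) := by
    rw [QuotientGroup.eq, inv_inv]
  rw [h1, ← e₁.injective.eq_iff, ← hf, ← hf, QuotientGroup.eq]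
  simp

/-! ### The `G`-set of subsets of a given size. -/

namespace FinGSet

open MulAction
open scoped Pointwise

/-- The `G`-set of subsets of `G` with `d` elements. -/
def subsets (G : Type u) [Group G] [Finite G] (d : ℕ) : FinGSet G :=
  letI : MulAction G {s : Set G // s.ncard = d} :=
    { smul := fun g s => ⟨g • s.1, by rw [Set.ncard_smul_set]; exact s.2⟩
      one_smul := fun s => Subtype.ext (one_smul G s.1)
      mul_smul := fun g h s => Subtype.ext (mul_smul g h s.1) }
  ⟨{s : Set G // s.ncard = d}⟩

/-- A subgroup, as a point of the `G`-set of subsets. -/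
def subsetsPoint {G : Type u} [Group G] [Finite G] (V : Subgroup G) :
    (subsets G (Nat.card V)).carrier :=
  ⟨V, rfl⟩

theorem forall_smul_set_eq_iff {G : Type u} [Group G] (U : Subgroup G) (s : Set G) :
    (∀ g ∈ U, g • s = s) ↔ ∀ x y, x * y⁻¹ ∈ U → y ∈ s → x ∈ s := by
  constructor
  · intro h x y hxy hy
    rw [← h _ hxy]
    exact ⟨y, hy, by simp⟩
  · intro h g hg
    ext x
    rw [Set.mem_smul_set_iff_inv_smul_mem]
    exact ⟨fun hx => h _ _ (by simpa using hg) hx,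
      fun hx => h _ _ (by simpa using inv_mem hg) hx⟩

/-- A subset is fixed by `U` exactly when it is a union of right cosets of `U`, a notion that the
coset-matching bijection transports. -/
theorem numFixed_subsets {C : Type v} [Group C] [Finite C] {G : Type u} [Group G] [Finite G]
    (hC : Nat.card C = Nat.card G) {V : Subgroup C} {U : Subgroup G}
    (h : Nat.card V = Nat.card U) (d : ℕ) :
    numFixed V (subsets C d) = numFixed U (subsets G d) := by
  obtain ⟨e, he⟩ := Subgroup.exists_equiv_mul_inv_mem_iff hC h
  refine Nat.card_congr (Equiv.subtypeEquiv (Equiv.subtypeEquiv (Equiv.Set.congr e) fun s => ?_)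
    fun s => ?_)
  · rw [Equiv.Set.congr_apply, Set.ncard_image_of_injective _ e.injective]
  · have h1 : (∀ g ∈ V, g • s = s) ↔ ∀ g ∈ V, g • s.1 = s.1 :=
      forall₂_congr fun g _ => Subtype.ext_iff
    rw [h1, forall_smul_set_eq_iff]
    refine Iff.trans ?_ (forall₂_congr fun g _ => Subtype.ext_iff).symm
    refine Iff.trans ?_ (forall_smul_set_eq_iff U (e '' s.1)).symm
    rw [← e.forall_congr_right]
    refine forall_congr' fun x => ?_
    rw [← e.forall_congr_right]
    refine forall_congr' fun y => ?_
    rw [← he, e.injective.mem_set_image, e.injective.mem_set_image]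

/-- In a cyclic group, the subsets of size `|V|` outside of the orbit of `V` have stabilizers of
order less than `|V|`. -/
theorem card_stabilizer_subsets_lt {C : Type v} [Group C] [Finite C] [IsCyclic C]
    (V : Subgroup C) {s : (subsets C (Nat.card V)).carrier}
    (hs : s ∉ orbit C (subsetsPoint V)) :
    Nat.card (stabilizer C s) < Nat.card V := by
  have hpos : 0 < Nat.card V := Nat.card_pos
  have hcard : s.1.ncard = Nat.card V := s.2
  obtain ⟨a, ha⟩ : s.1.Nonempty := (Set.ncard_pos (s := s.1)).1 (by rw [hcard]; exact hpos)
  -- With `S` the stabilizer, `s` contains the coset `Sa`, so `|S| ≤ |V|`. Equality would give `S =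
  -- V` and `s = Va = aV`, a point of the excluded orbit.
  have hsub : (fun x => x * a) '' (stabilizer C s : Set C) ⊆ s.1 := by
    rintro _ ⟨g, hg, rfl⟩
    have hg' : g • s.1 = s.1 := congrArg Subtype.val hg
    rw [← hg']
    exact ⟨a, ha, rfl⟩
  have hn : ((fun x => x * a) '' (stabilizer C s : Set C)).ncard = Nat.card (stabilizer C s) :=
    (Set.ncard_image_of_injective _ (mul_left_injective a)).trans (Nat.card_coe_set_eq _).symm
  refine lt_of_le_of_ne (hn.symm.le.trans ((Set.ncard_le_ncard hsub).trans hcard.le)) fun heq => hs ?_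
  have hV := IsCyclic.subgroup_eq_of_card_eq heq
  have hs' := Set.eq_of_subset_of_ncard_le hsub (by rw [hn, heq, hcard])
  rw [hV] at hs'
  refine ⟨a, Subtype.ext (Eq.trans ?_ hs')⟩
  exact Set.image_congr fun x _ => (IsCyclic.isMulCommutative (α := C)).is_comm.comm a x

theorem stabilizer_subsets_self {C : Type v} [Group C] [Finite C] (V : Subgroup C) :
    stabilizer C (subsetsPoint V) = V := by
  ext g
  refine (Subtype.ext_iff (a1 := g • subsetsPoint V)).trans ?_
  constructor
  · intro h
    have h' : g • (V : Set C) = V := h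
    have : g * 1 ∈ (V : Set C) := by
      rw [← h']
      exact ⟨1, V.one_mem, rfl⟩
    simpa using this
  · intro h
    exact smul_coe_set h

end FinGSet

/-! ### Existence and uniqueness of the Frobenius–Wielandt morphism. -/

/-- Equality of marks along subgroups of equal order. -/
def SameMarks {C : Type v} [Group C] {G : Type u} [Group G] (x : BurnsideRing C)
    (y : BurnsideRing G) : Prop :=
  ∀ (U : Subgroup G) (V : Subgroup C), Nat.card V = Nat.card U →
    BurnsideRing.fixed U y = BurnsideRing.fixed V x

namespace BurnsideRing

variable {C : Type v} [Group C] {G : Type u} [Group G]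

theorem of_mk_eq_of_iso {X Y Z : FinGSet G} (h : FinGSet.Iso (FinGSet.sum X Y) Z) :
    (of (GSetClass.mk Z) : BurnsideRing G) = of (GSetClass.mk X) + of (GSetClass.mk Y) := by
  rw [← map_add]
  exact congrArg of (Quotient.sound h.symm)

theorem exists_sameMarks_of_stabilizers [Finite C] {d : ℕ}
    (ih : ∀ V : Subgroup C, Nat.card V < d →
      ∃ y : BurnsideRing G, SameMarks (of (GSetClass.mk (FinGSet.coset V))) y)
    (X : FinGSet C) (hX : ∀ x : X.carrier, Nat.card (MulAction.stabilizer C x) < d) :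
    ∃ y : BurnsideRing G, SameMarks (of (GSetClass.mk X)) y := by
  induction hn : Nat.card X.carrier using Nat.strong_induction_on generalizing X with
  | _ n ihn =>
  rcases isEmpty_or_nonempty X.carrier with hE | ⟨⟨x⟩⟩
  · refine ⟨0, fun U V _ => ?_⟩
    have : IsEmpty {x : X.carrier // ∀ g ∈ V, g • x = x} := inferInstance
    rw [map_zero, fixed_of_mk, FinGSet.numFixed, Nat.card_of_isEmpty, Nat.cast_zero]
  · obtain ⟨y, hy⟩ := ih _ (hX x)
    obtain ⟨z, hz⟩ := ihn _ (hn ▸ FinGSet.card_orbCompl_lt X x) (FinGSet.orbCompl X x)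
      (fun t => by rw [FinGSet.stabilizer_orbCompl]; exact hX _) rfl
    refine ⟨y + z, fun U V h => ?_⟩
    rw [of_mk_eq_of_iso (FinGSet.iso_coset_sum_orbCompl X x), map_add, map_add, hy U V h,
      hz U V h]

/-- The orbit of `V` among the `|V|`-element subsets of `C` is `C/V`, and the remaining orbits have
stabilizers of smaller order. Hence `[C/V]` is the class of all these subsets minus a class handled
by induction. -/
theorem exists_sameMarks_coset [Finite C] [IsCyclic C] [Finite G]
    (hC : Nat.card C = Nat.card G) (V : Subgroup C) :
    ∃ y : BurnsideRing G, SameMarks (of (GSetClass.mk (FinGSet.coset V))) y := by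
  induction hn : Nat.card V using Nat.strong_induction_on generalizing V with
  | _ n ih =>
  have hiso := FinGSet.iso_coset_sum_orbCompl _ (FinGSet.subsetsPoint V)
  rw [FinGSet.stabilizer_subsets_self] at hiso
  obtain ⟨z, hz⟩ := exists_sameMarks_of_stabilizers (G := G) (d := Nat.card V)
    (fun W hW => ih _ (hn ▸ hW) W rfl) (FinGSet.orbCompl _ (FinGSet.subsetsPoint V))
    (fun t => by
      rw [FinGSet.stabilizer_orbCompl]
      exact FinGSet.card_stabilizer_subsets_lt V t.2)
  refine ⟨of (GSetClass.mk (FinGSet.subsets G (Nat.card V))) - z, fun U W h => ?_⟩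
  rw [eq_sub_of_add_eq (of_mk_eq_of_iso hiso).symm, map_sub, map_sub, hz U W h, fixed_of_mk U,
    fixed_of_mk W (FinGSet.subsets _ _), FinGSet.numFixed_subsets hC h]

theorem exists_sameMarks [Finite C] [IsCyclic C] [Finite G]
    (hC : Nat.card C = Nat.card G) (x : BurnsideRing C) :
    ∃ y : BurnsideRing G, SameMarks x y := by
  have key : ∀ X : FinGSet C, ∃ y : BurnsideRing G, SameMarks (of (GSetClass.mk X)) y := fun X =>
    -- Every stabilizer has order below `|C| + 1`, so the bound excludes nothing.
    exists_sameMarks_of_stabilizers (d := Nat.card C + 1)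
      (fun V _ => exists_sameMarks_coset hC V) X
      fun x => Nat.lt_succ_of_le (Subgroup.card_le_card_group _)
  induction x using induction_on with | h a b =>
  obtain ⟨X, rfl⟩ := Quotient.exists_rep a
  obtain ⟨Y, rfl⟩ := Quotient.exists_rep b
  obtain ⟨y, hy⟩ := key X
  obtain ⟨z, hz⟩ := key Y
  refine ⟨y - z, fun U V h => ?_⟩
  rw [map_sub, map_sub, hy U V h, hz U V h]
  rfl

theorem ext_of_isCyclic [Finite C] [IsCyclic C] [Finite G] (hC : Nat.card C = Nat.card G)
    {a b : BurnsideRing G} (h : ∀ (U : Subgroup G) (V : Subgroup C), Nat.card V = Nat.card U →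
      fixed U a = fixed U b) : a = b :=
  ext_fixed fun U =>
    have ⟨V, hV⟩ := IsCyclic.exists_subgroup_card_eq (hC ▸ Subgroup.card_subgroup_dvd_card U)
    h U V hV

/-- Existence and uniqueness of the Frobenius–Wielandt morphism. -/
theorem existsUnique_isFrobeniusWielandt [Finite C] [IsCyclic C] [Finite G]
    (hC : Nat.card C = Nat.card G) :
    ∃! α : BurnsideRing C →+* BurnsideRing G, IsFrobeniusWielandt α := by
  choose f hf using exists_sameMarks (C := C) (G := G) hC
  -- A pointwise choice is automatically a ring homomorphism: marks are ring homomorphisms and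
  -- jointly injective on `B(G)`.
  refine ⟨{ toFun := f, map_one' := ?_, map_mul' := ?_, map_zero' := ?_, map_add' := ?_ },
    fun U V h x => hf x U V h, fun β hβ => RingHom.ext fun x => ?_⟩
  · exact ext_of_isCyclic hC fun U V h => by rw [hf _ U V h, map_one, map_one]
  · exact fun x y => ext_of_isCyclic hC fun U V h => by
      rw [map_mul, hf _ U V h, hf _ U V h, hf _ U V h, map_mul]
  · exact ext_of_isCyclic hC fun U V h => by rw [hf _ U V h, map_zero, map_zero]
  · exact fun x y => ext_of_isCyclic hC fun U V h => by
      rw [map_add, hf _ U V h, hf _ U V h, hf _ U V h, map_add]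
  · exact ext_of_isCyclic hC fun U V h => (hβ U V h x).trans (hf x U V h).symm

end BurnsideRing

/-! ### Marks of induced elements. -/

namespace Subgroup

variable {G : Type u} [Group G]

/-- The conjugate `g⁻¹ U g`. -/
def conjInv (U : Subgroup G) (g : G) : Subgroup G := U.comap (MulAut.conj g).toMonoidHom

theorem mem_conjInv {U : Subgroup G} {g x : G} : x ∈ U.conjInv g ↔ g * x * g⁻¹ ∈ U := Iff.rfl

theorem conjInv_one (U : Subgroup G) : U.conjInv 1 = U := by
  ext x
  simp [mem_conjInv]

theorem card_conjInv (U : Subgroup G) (g : G) : Nat.card (U.conjInv g) = Nat.card U :=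
  Nat.card_congr ((MulAut.conj g).toEquiv.subtypeEquiv fun _ => Iff.rfl)

end Subgroup

namespace FinGSet

variable {G : Type u} [Group G]

open Subgroup

/-- The element of `H` relating `(ug, x)` to `(g, x)` is forced by the first coordinates to be
`g⁻¹ug`. -/
theorem smul_mk_eq_iff (H : Subgroup G) (X : FinGSet H) (u g : G) (x : X.carrier) :
    (u • (Quotient.mk (indSetoid H X) (g, x)) = Quotient.mk (indSetoid H X) (g, x)) ↔
      ∃ h : H, g⁻¹ * u * g = h ∧ h • x = x := by
  constructor
  · intro e
    obtain ⟨h, hh⟩ := Quotient.exact (s := indSetoid H X) e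
    obtain ⟨h1, h2⟩ := Prod.mk.inj hh
    refine ⟨h, ?_, h2.symm⟩
    have h1' : g = u * g * (h : G)⁻¹ := h1
    rw [mul_assoc, inv_mul_eq_iff_eq_mul]
    exact (eq_mul_inv_iff_mul_eq.1 h1').symm
  · rintro ⟨h, h1, h2⟩
    refine Quotient.sound ⟨h, Prod.ext ?_ h2.symm⟩
    change g = u * g * (h : G)⁻¹
    rw [← h1]
    group

theorem forall_smul_mk_eq_iff (H U : Subgroup G) (X : FinGSet H) (g : G) (x : X.carrier) :
    (∀ u ∈ U, u • (Quotient.mk (indSetoid H X) (g, x)) = Quotient.mk (indSetoid H X) (g, x)) ↔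
      U.conjInv g ≤ H ∧ ∀ h ∈ (U.conjInv g).subgroupOf H, h • x = x := by
  constructor
  · intro hu
    have key : ∀ y ∈ U.conjInv g, ∃ h : H, y = h ∧ h • x = x := fun y hy => by
      obtain ⟨h, h1, h2⟩ := (smul_mk_eq_iff H X _ g x).1 (hu _ (mem_conjInv.1 hy))
      exact ⟨h, by rw [← h1]; group, h2⟩
    refine ⟨fun y hy => ?_, fun k hk => ?_⟩
    · obtain ⟨h, rfl, -⟩ := key y hy
      exact h.2
    · obtain ⟨h, h1, h2⟩ := key k hk
      rwa [Subtype.ext h1]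
  · rintro ⟨hle, hfix⟩ u hu
    have hm : g⁻¹ * u * g ∈ U.conjInv g := by
      rw [mem_conjInv]
      convert hu using 1
      group
    exact (smul_mk_eq_iff H X u g x).2 ⟨⟨_, hle hm⟩, rfl, hfix _ hm⟩

variable [Finite G]

/-- `H` acts freely on `G × X`, so each point of `G ×_H X` has exactly `|H|` representatives. -/
theorem card_fixed_pairs (H U : Subgroup G) (X : FinGSet H) :
    Nat.card {p : G × X.carrier // ∀ u ∈ U,
      u • (Quotient.mk (indSetoid H X) p) = Quotient.mk (indSetoid H X) p} =
      numFixed U (ind H X) * Nat.card H := by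
  let P : Quotient (indSetoid H X) → Prop := fun q => ∀ u ∈ U, u • q = q
  let F : {q : Quotient (indSetoid H X) // P q} × H →
      {p : G × X.carrier // P (Quotient.mk (indSetoid H X) p)} := fun z =>
    ⟨(z.1.1.out.1 * (z.2 : G)⁻¹, z.2 • z.1.1.out.2), by
      have : Quotient.mk (indSetoid H X) (z.1.1.out.1 * (z.2 : G)⁻¹, z.2 • z.1.1.out.2) =
          z.1.1 := by
        conv_rhs => rw [← Quotient.out_eq z.1.1]
        exact (Quotient.sound (s := indSetoid H X) ⟨z.2, rfl⟩).symm
      rw [this]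
      exact z.1.2⟩
  have hmk : ∀ z, Quotient.mk (indSetoid H X) (F z).1 = z.1.1 := fun z => by
    conv_rhs => rw [← Quotient.out_eq z.1.1]
    exact (Quotient.sound (s := indSetoid H X) ⟨z.2, rfl⟩).symm
  have hF : Function.Bijective F := by
    constructor
    · intro z w hzw
      have h1 : z.1 = w.1 := Subtype.ext (by rw [← hmk z, ← hmk w, hzw])
      have h2 := congrArg (fun p => p.1.1) hzw
      change z.1.1.out.1 * (z.2 : G)⁻¹ = w.1.1.out.1 * (w.2 : G)⁻¹ at h2
      rw [h1] at h2
      exact Prod.ext h1 (Subtype.ext (inv_injective (mul_left_cancel h2)))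
    · rintro ⟨p, hp⟩
      obtain ⟨h, hh⟩ := Quotient.exact (s := indSetoid H X)
        (Quotient.out_eq (Quotient.mk (indSetoid H X) p))
      exact ⟨(⟨_, hp⟩, h), Subtype.ext hh.symm⟩
  exact (Nat.card_congr (Equiv.ofBijective F hF)).symm.trans (Nat.card_prod _ _)

-- Multiplying by `|H|` lets the sum run over all of `G` and avoids coset representatives: the pairs
-- `(g, x)` representing fixed points are counted by their first coordinate.
open scoped Classical in
theorem numFixed_ind_mul_card [Fintype G] (H U : Subgroup G) (X : FinGSet H) :
    numFixed U (ind H X) * Nat.card H =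
      ∑ g : G, if U.conjInv g ≤ H then numFixed ((U.conjInv g).subgroupOf H) X else 0 := by
  rw [← card_fixed_pairs]
  have e : {p : G × X.carrier // ∀ u ∈ U,
      u • (Quotient.mk (indSetoid H X) p) = Quotient.mk (indSetoid H X) p} ≃
      Σ g : G, {x : X.carrier // ∀ u ∈ U,
        u • (Quotient.mk (indSetoid H X) (g, x)) = Quotient.mk (indSetoid H X) (g, x)} :=
    { toFun := fun p => ⟨p.1.1, p.1.2, p.2⟩
      invFun := fun s => ⟨(s.1, s.2.1), s.2.2⟩
      left_inv := fun _ => rfl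
      right_inv := fun _ => rfl }
  rw [Nat.card_congr e, Nat.card_sigma]
  refine Finset.sum_congr rfl fun g _ => ?_
  rw [Nat.card_congr (Equiv.subtypeEquivRight fun x => forall_smul_mk_eq_iff H U X g x)]
  split_ifs with hg
  · exact Nat.card_congr (Equiv.subtypeEquivRight fun x => and_iff_right hg)
  · have : IsEmpty {x : X.carrier //
        U.conjInv g ≤ H ∧ ∀ h ∈ (U.conjInv g).subgroupOf H, h • x = x} := ⟨fun x => hg x.2.1⟩
    exact Nat.card_of_isEmpty

end FinGSet

namespace BurnsideRing

section

variable {G : Type u} [Group G] [Finite G]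

theorem ind_of_mk (H : Subgroup G) (X : FinGSet H) :
    ind H (of (GSetClass.mk X)) = of (GSetClass.mk (FinGSet.ind H X)) :=
  lift_of _ _

open scoped Classical in
/-- The marks of an induced element. -/
theorem fixed_ind_mul_card [Fintype G] (H U : Subgroup G) (x : BurnsideRing H) :
    fixed U (ind H x) * (Nat.card H : ℤ) =
      ∑ g : G, if U.conjInv g ≤ H then fixed ((U.conjInv g).subgroupOf H) x else 0 := by
  have key : ∀ X : FinGSet H, fixed U (ind H (of (GSetClass.mk X))) * (Nat.card H : ℤ) =
      ∑ g : G, if U.conjInv g ≤ H then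
        fixed ((U.conjInv g).subgroupOf H) (of (GSetClass.mk X)) else 0 := fun X => by
    simp only [ind_of_mk, fixed_of_mk]
    exact_mod_cast FinGSet.numFixed_ind_mul_card H U X
  induction x using induction_on with | h a b =>
  obtain ⟨X, rfl⟩ := Quotient.exists_rep a
  obtain ⟨Y, rfl⟩ := Quotient.exists_rep b
  refine Eq.trans ?_ ((congrArg₂ (· - ·) (key X) (key Y)).trans ?_)
  · rw [← sub_mul, ← map_sub, ← map_sub]
    rfl
  · rw [← Finset.sum_sub_distrib]
    refine Finset.sum_congr rfl fun g _ => ?_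
    split_ifs
    · exact (map_sub _ _ _).symm
    · exact sub_zero 0

theorem fixed_ind_of_forall_not_le (H U : Subgroup G) (x : BurnsideRing H)
    (h : ∀ g : G, ¬ U.conjInv g ≤ H) : fixed U (ind H x) = 0 := by
  have := Fintype.ofFinite G
  have h1 := fixed_ind_mul_card H U x
  rw [Finset.sum_eq_zero fun g _ => if_neg (h g)] at h1
  exact (mul_eq_zero.1 h1).resolve_right (by exact_mod_cast Nat.card_pos.ne')

theorem fixed_ind_mul_card_of_forall_eq (H U : Subgroup G) (x : BurnsideRing H) (m : ℤ)
    (h : ∀ g : G, U.conjInv g ≤ H ∧ fixed ((U.conjInv g).subgroupOf H) x = m) :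
    fixed U (ind H x) * (Nat.card H : ℤ) = Nat.card G * m := by
  have := Fintype.ofFinite G
  rw [fixed_ind_mul_card, Finset.sum_congr rfl fun g _ => (if_pos (h g).1).trans (h g).2,
    Finset.sum_const, nsmul_eq_mul, Finset.card_univ, Nat.card_eq_fintype_card]

/-- All marks of `1` are `1`, so the sum counts the `g` with `g⁻¹Ug ≤ H`. A count of `|G|` leaves no
exception, not even `g = 1`. -/
theorem le_of_fixed_ind_one (H U : Subgroup G)
    (h : fixed U (ind H 1) * (Nat.card H : ℤ) = Nat.card G) : U ≤ H := by
  classical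
  have := Fintype.ofFinite G
  rw [fixed_ind_mul_card] at h
  simp only [map_one] at h
  rw [Finset.sum_boole, Nat.card_eq_fintype_card] at h
  have h' := Finset.card_eq_iff_eq_univ _ |>.1 (Nat.cast_injective (R := ℤ) h)
  have h1 : (1 : G) ∈ Finset.univ.filter fun g : G => U.conjInv g ≤ H := by
    rw [h']
    exact Finset.mem_univ 1
  rw [← U.conjInv_one]
  exact (Finset.mem_filter.1 h1).2

end

end BurnsideRing

/-! ### The gcd property as a containment condition, and normality. -/

section

variable {G : Type u} [Group G]

theorem GcdProperty.le_of_card_dvd {H : Subgroup G} [Finite G] (h : GcdProperty H)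
    {U : Subgroup G} (hU : Nat.card U ∣ Nat.card H) : U ≤ H := by
  have h1 := h U
  rw [Nat.gcd_eq_left hU] at h1
  exact inf_eq_left.1 (Subgroup.eq_of_le_of_card_ge inf_le_left h1.ge)

theorem gcdProperty_iff [Finite G] {H : Subgroup G} :
    GcdProperty H ↔ ∀ U : Subgroup G, Nat.card U ∣ Nat.card H → U ≤ H := by
  refine ⟨fun h U => h.le_of_card_dvd, fun h K => Nat.dvd_antisymm
    (Nat.dvd_gcd (Subgroup.card_dvd_of_le inf_le_left) (Subgroup.card_dvd_of_le inf_le_right)) ?_⟩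
  -- A prime power dividing the gcd is the order of a subgroup of `K`, which lies in `H` by
  -- assumption and so in `K ⊓ H`.
  rw [Nat.dvd_iff_prime_pow_dvd_dvd]
  intro p k hp hk
  have := Fact.mk hp
  obtain ⟨P, hP⟩ := Sylow.exists_subgroup_card_pow_prime p (hk.trans (Nat.gcd_dvd_left _ _))
  have hP' : Nat.card (P.map K.subtype) = p ^ k := by
    rw [← hP]
    exact Nat.card_congr (P.equivMapOfInjective _ K.subtype_injective).symm.toEquiv
  rw [← hP']
  exact Subgroup.card_dvd_of_le (le_inf (Subgroup.map_subtype_le P)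
    (h _ (hP' ▸ hk.trans (Nat.gcd_dvd_right _ _))))

theorem GcdProperty.normal [Finite G] {H : Subgroup G} (h : GcdProperty H) : H.Normal := by
  refine ⟨fun n hn g => ?_⟩
  refine h.le_of_card_dvd (H.card_conjInv g⁻¹).dvd (Subgroup.mem_conjInv.2 ?_)
  convert hn using 1
  group

end

/-! ### Comparison of the two composites. -/

namespace IsFrobeniusWielandt

variable {G : Type u} [Group G] {C : Type v} [Group C] [Finite C] [IsCyclic C]
  {H : Subgroup G} {CH : Subgroup C} {αG : BurnsideRing C →+* BurnsideRing G}
  {αH : BurnsideRing CH →+* BurnsideRing H}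

open BurnsideRing Subgroup

/-- In `C` every conjugate of `V` is `V`, and `V ≤ CH` by divisibility, so the sum for the mark of
`ind CH x` has `|C| = |G|` equal terms. -/
theorem fixed_ind_mul_card (hG : IsFrobeniusWielandt αG) (hC : Nat.card C = Nat.card G)
    (hCH : Nat.card CH = Nat.card H) {U : Subgroup G} {V : Subgroup C}
    (hV : Nat.card V = Nat.card U) (hU : Nat.card U ∣ Nat.card H) (x : BurnsideRing CH) :
    fixed U (αG (ind CH x)) * (Nat.card H : ℤ) = Nat.card G * fixed (V.subgroupOf CH) x := by
  rw [hG U V hV, ← hC, ← hCH]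
  refine fixed_ind_mul_card_of_forall_eq CH V x _ fun g => ?_
  have : V.conjInv g = V := IsCyclic.subgroup_eq_of_card_eq (V.card_conjInv g)
  rw [this]
  exact ⟨IsCyclic.subgroup_le_of_card_dvd (by rwa [hV, hCH]), rfl⟩

theorem comp_ind_eq_iff [Finite G] (hG : IsFrobeniusWielandt αG) (hH : IsFrobeniusWielandt αH)
    (hC : Nat.card C = Nat.card G) (hCH : Nat.card CH = Nat.card H) :
    ((αG : BurnsideRing C →+ BurnsideRing G).comp (ind CH) =
      (ind H).comp (αH : BurnsideRing CH →+ BurnsideRing H)) ↔ GcdProperty H := by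
  have hex : ∀ U : Subgroup G, ∃ V : Subgroup C, Nat.card V = Nat.card U := fun U =>
    IsCyclic.exists_subgroup_card_eq (hC ▸ Subgroup.card_subgroup_dvd_card U)
  rw [gcdProperty_iff]
  constructor
  · intro h U hU
    obtain ⟨V, hV⟩ := hex U
    refine le_of_fixed_ind_one H U ?_
    have h1 : αG (ind CH 1) = ind H 1 :=
      (DFunLike.congr_fun h 1).trans (congrArg (ind H) (map_one αH))
    rw [← h1, fixed_ind_mul_card hG hC hCH hV hU, map_one, mul_one]
  · intro h
    refine AddMonoidHom.ext fun x => ext_fixed fun U => ?_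
    change fixed U (αG (ind CH x)) = fixed U (ind H (αH x))
    obtain ⟨V, hV⟩ := hex U
    by_cases hU : Nat.card U ∣ Nat.card H
    · have hV' : V ≤ CH := IsCyclic.subgroup_le_of_card_dvd (by rwa [hV, hCH])
      have h0 : (Nat.card H : ℤ) ≠ 0 := by exact_mod_cast Nat.card_pos.ne'
      refine mul_right_cancel₀ h0 ?_
      rw [fixed_ind_mul_card hG hC hCH hV hU]
      refine (fixed_ind_mul_card_of_forall_eq H U _ _ fun g => ?_).symm
      have hg : U.conjInv g ≤ H := h _ (by rwa [card_conjInv])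
      refine ⟨hg, hH _ _ ?_ x⟩
      rw [Nat.card_congr (subgroupOfEquivOfLe hV').toEquiv,
        Nat.card_congr (subgroupOfEquivOfLe hg).toEquiv, card_conjInv, hV]
    -- No conjugate of `U` fits in `H`, nor one of `V` in `CH`, by Lagrange: both marks are zero.
    · rw [hG U V hV, fixed_ind_of_forall_not_le CH V x fun g hg => hU ?_,
        fixed_ind_of_forall_not_le H U _ fun g hg => hU ?_]
      · rw [← card_conjInv U g]
        exact Subgroup.card_dvd_of_le hg
      · rw [← hV, ← hCH, ← card_conjInv V g]
        exact Subgroup.card_dvd_of_le hg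

end IsFrobeniusWielandt

theorem mainTheorem3 {G : Type u} [Group G] [Finite G] {C : Type v} [Group C] [Finite C]
    [IsCyclic C] (hC : Nat.card C = Nat.card G) (H : Subgroup G) (CH : Subgroup C)
    (hCH : Nat.card CH = Nat.card H) :
    (∃! αG : BurnsideRing C →+* BurnsideRing G, IsFrobeniusWielandt αG) ∧
    (∃! αH : BurnsideRing CH →+* BurnsideRing H, IsFrobeniusWielandt αH) ∧
    ∀ (αG : BurnsideRing C →+* BurnsideRing G) (αH : BurnsideRing CH →+* BurnsideRing H),
      IsFrobeniusWielandt αG → IsFrobeniusWielandt αH →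
        (((αG : BurnsideRing C →+ BurnsideRing G).comp (BurnsideRing.ind CH) =
            (BurnsideRing.ind H).comp (αH : BurnsideRing CH →+ BurnsideRing H)) ↔
          GcdProperty H) ∧
        (GcdProperty H → H.Normal) := by
  exact ⟨BurnsideRing.existsUnique_isFrobeniusWielandt hC,
    BurnsideRing.existsUnique_isFrobeniusWielandt hCH, fun _ _ hG hH =>
      ⟨hG.comp_ind_eq_iff hH hC hCH, GcdProperty.normal⟩⟩
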